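/- Let $X$ be a real random variable with law $P$ and mean $\theta_0=\mathbb E[X]$, and let $\xi=X-\theta_0$. Let $\alpha\in[0,1]$, $\alpha\neq\tfrac12$, and $$p=p_2(\alpha)=\tfrac12+\tfrac12\alpha+\alpha^2 .$$ Write $c_2=\mathbb E[\xi^2]$, $\nu_q=\mathbb E[|\xi|^q]$ and $\sigma_q=\mathbb E[\operatorname{sign}(\xi)|\xi|^q]$. The degree-2 Form-B PATP (Parametrically Adaptive Transition Polynomial) basis is $\varphi_1(\xi)=\xi$, $\varphi_2(\xi)=\operatorname{sign}(\xi)|\xi|^{p}$. For $i,j\in\{1,2\}$ put $\Psi_i(\theta)=\mathbb E[\varphi_i(X-\theta)]$, let $\mathbf F=(F_{ij})$ with $F_{ij}=\mathbb E[\varphi_i(\xi)\varphi_j(\xi)]-\mathbb E[\varphi_i(\xi)]\,\mathbb E[\varphi_j(\xi)]$ be the matrix of centered correlants, and let $\vec b=(b_1,b_2)$ with $b_i=-\Psi_i'(\theta_0)$ (the sign is a normalization that does not affect $\vec b^{\top}\mathbf F^{-1}\vec b$). For sample size $N\ge 1$, the asymptotic variance of the degree-2 PATP location estimator is $V_N=1/(N\,\vec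 b^{\top}\mathbf F^{-1}\vec b)$, and the variance-reduction coefficient $g_2(\alpha)$ relative to OLS is $V_N$ divided by the variance of the sample mean of $N$ i.i.d. copies of $X$. Assume that $c_2,\nu_{p-1},\nu_{p+1},\nu_{2p}$ and $\sigma_p$ are finite, that $\mathbb P(\xi=0)=0$ if $p<1$, and that $\det\mathbf F>0$. Then: 1. $F_{11}=c_2$, $F_{12}=F_{21}=\nu_{p+1}$, $F_{22}=\nu_{2p}-\sigma_p^2$; the functions $\Psi_1,\Psi_2$ are differentiable at $\theta_0$, with $\Psi_1'(\theta_0)=-1$ and $\Psi_2'(\theta_0)=-p\,\nu_{p-1}$, so $\vec b=(1,\;p\,\nu_{p-1})$. 2. For every $N\ge1$, the sample mean has variance $c_2/N$. Moreover, let $x_1,\dots,x_N$ be i.i.d. copies of $X$ and, for $\vec h\in\mathbb R^2$ with $\vec h^{\top}\vec b\ne0$, let $$\hat\theta_{\vec h}=\theta_0+\frac{\sum_{i=1}^{2}h_i\,\frac1N\sum_{n=1}^N\varphi_i(x_n-\theta_0)}{\vec h^{\top}\vec b}$$ be the linearized estimator with coefficients $\vec h$. Then $\operatorname{Var}[\hat\theta_{\vec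 h}]\ge V_N$, with equality for $\vec h=\vec h^{*}=\mathbf F^{-1}\vec b$, which satisfies $\mathbf F\vec h^{*}=\vec b$. 3. $c_2>0$, $(\nu_{2p}-\sigma_p^2)-2p\,\nu_{p+1}\nu_{p-1}+p^2c_2\nu_{p-1}^2>0$, and, for every $N\ge1$, $$g_2(\alpha)=\frac{1}{c_2\,\vec b^{\top}\mathbf F^{-1}\vec b}=\frac{c_2(\nu_{2p}-\sigma_p^2)-\nu_{p+1}^2}{c_2\bigl[(\nu_{2p}-\sigma_p^2)-2p\,\nu_{p+1}\nu_{p-1}+p^2c_2\nu_{p-1}^2\bigr]} .$$ 4. If $\alpha=1$ and the law of $\xi$ is symmetric ($\xi$ and $-\xi$ have the same law), then $$g_2(1)=\frac{c_2\nu_4-\nu_3^2}{c_2\bigl(\nu_4-4\nu_3\nu_1+4c_2\nu_1^2\bigr)} .$$ -/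

import Mathlib

open MeasureTheory ProbabilityTheory Matrix

namespace PATP

noncomputable section

/-! Throughout, `P` is the law on `ℝ` of one observation `X`, `θ` is a value of the location
parameter and `ξ = X - θ` is the corresponding residual. -/

/-- The exponent `p_i(α)`: the quadratic polynomial in `α` with values `1/i`, `1`, `i` at
`0`, `1/2`, `1`. -/
def exponent (i : ℕ) (α : ℝ) : ℝ :=
  1 / (i : ℝ) + (4 - (i : ℝ) - 3 / (i : ℝ)) * α + (2 * (i : ℝ) - 4 + 2 / (i : ℝ)) * α ^ 2

/-- The signed-parity (Form B) basis, `i = 1, 2, …`: `φ₁(ξ) = ξ` and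
`φ_i(ξ; α) = sign(ξ) |ξ| ^ p_i(α)` for `i ≥ 2`. -/
def basis (α : ℝ) (i : ℕ) (ξ : ℝ) : ℝ :=
  if i = 1 then ξ else Real.sign ξ * |ξ| ^ exponent i α

/-- Second moment of the residual, `c₂ = E[ξ²]` (the variance of `X` when `θ = E[X]`). -/
def c₂ (P : Measure ℝ) (θ : ℝ) : ℝ := ∫ x, (x - θ) ^ 2 ∂P

/-- Absolute fractional moment `ν_q = E[|ξ| ^ q]`. -/
def ν (P : Measure ℝ) (θ q : ℝ) : ℝ := ∫ x, |x - θ| ^ q ∂P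

/-- Signed fractional moment `σ_q = E[sign(ξ) |ξ| ^ q]`. -/
def σ (P : Measure ℝ) (θ q : ℝ) : ℝ := ∫ x, Real.sign (x - θ) * |x - θ| ^ q ∂P

/-- `Ψ_i(θ) = E[φ_i(X - θ; α)]`. -/
def Ψ (P : Measure ℝ) (α : ℝ) (i : ℕ) (θ : ℝ) : ℝ := ∫ x, basis α i (x - θ) ∂P

/-- `Ψ_ij(θ) = E[φ_i(X - θ; α) φ_j(X - θ; α)]`. -/
def Ψ₂ (P : Measure ℝ) (α : ℝ) (i j : ℕ) (θ : ℝ) : ℝ :=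
  ∫ x, basis α i (x - θ) * basis α j (x - θ) ∂P

/-- The `S × S` matrix of centered correlants `F_ij = Ψ_ij - Ψ_i Ψ_j`, `i, j = 1, …, S`
(the index `i : Fin S` stands for `i + 1`). -/
def F (P : Measure ℝ) (θ α : ℝ) (S : ℕ) : Matrix (Fin S) (Fin S) ℝ :=
  Matrix.of fun i j =>
    Ψ₂ P α (i + 1) (j + 1) θ - Ψ P α (i + 1) θ * Ψ P α (j + 1) θ

/-- The vector `b_i = -∂Ψ_i/∂θ`, `i = 1, …, S`. The common sign `-1` is the usual normalization;
it does not affect the quadratic form `bᵀ F⁻¹ b`. -/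
def b (P : Measure ℝ) (θ α : ℝ) (S : ℕ) : Fin S → ℝ :=
  fun i => -deriv (Ψ P α (i + 1)) θ

/-- The optimal coefficients `h* = F⁻¹ b`, solving the normal equations `F h* = b`. -/
def optimalCoeff (P : Measure ℝ) (θ α : ℝ) (S : ℕ) : Fin S → ℝ :=
  (F P θ α S)⁻¹ *ᵥ b P θ α S

/-- The law of an i.i.d. sample of size `N` from `P`. -/
def sampleLaw (P : Measure ℝ) (N : ℕ) : Measure (Fin N → ℝ) := Measure.pi fun _ => P

/-- The ordinary least squares estimator of location: the sample mean. -/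
def olsEstimator (N : ℕ) (x : Fin N → ℝ) : ℝ := (∑ n, x n) / N

/-- The variance of the ordinary least squares estimator for an i.i.d. sample of size `N`. -/
def olsVariance (P : Measure ℝ) (N : ℕ) : ℝ := variance (olsEstimator N) (sampleLaw P N)

/-- The location estimator with coefficients `h`, linearized at `θ`, i.e. the Newton step
`θ + (∑ i, h_i (1/N) ∑ n, φ_i(x_n - θ)) / (∑ i, h_i b_i)`. -/
def linearizedEstimator (P : Measure ℝ) (θ α : ℝ) (S : ℕ) (h : Fin S → ℝ) (N : ℕ)
    (x : Fin N → ℝ) : ℝ :=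
  θ + (∑ i, h i * ((∑ n, basis α (i + 1) (x n - θ)) / N)) / (h ⬝ᵥ b P θ α S)

/-- The asymptotic variance `1 / (N bᵀ F⁻¹ b)` of the degree-`S` estimator. -/
def patpVariance (P : Measure ℝ) (θ α : ℝ) (S N : ℕ) : ℝ :=
  1 / (N * (b P θ α S ⬝ᵥ ((F P θ α S)⁻¹ *ᵥ b P θ α S)))

/-- The variance reduction coefficient `g_S(α)`: the asymptotic variance of the degree-`S`
estimator divided by the variance of ordinary least squares, at sample size `N`. -/
def g (P : Measure ℝ) (θ α : ℝ) (S N : ℕ) : ℝ := patpVariance P θ α S N / olsVariance P N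

end

end PATP

/-!
The correlants are moments of the residual `ξ = X - θ₀`: the signed power
`φ₂(ξ) = sign(ξ)|ξ|^p` satisfies `ξ φ₂(ξ) = |ξ|^(p+1)` and `φ₂(ξ)² = |ξ|^(2p)`, and `ξ` is
centered.

The analytic point is the derivative of `θ ↦ E[φ₂(X - θ)]` at `θ₀`, where only
`E|ξ|^(p-1) < ∞` at `θ₀` itself is available. For `p > 1` the mean value theorem and the
subadditivity of `t ↦ t^(p-1)` (recall `p ≤ 2`) dominate the difference quotients by
`p (|ξ|^(p-1) + 1)`. For `p < 1` the derivative of `φ₂` is unbounded at the origin, and in general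
no integrable local Lipschitz bound exists. However, `φ₂` is multiplicative, so that the
difference quotients based at `ξ ≠ 0` reduce by scaling to those based at `1`, which are bounded by `2`
(`abs_signedPow_sub_one_le`). Hence they are dominated by `2|ξ|^(p-1)`, and dominated convergence
at the single point `θ₀` applies (`hasDerivAt_integral_signedPow`).

The matrix `F` is the covariance matrix of `(φ₁(ξ), φ₂(ξ))`, so by independence the linearized
estimator has variance `hᵀFh / (N (hᵀb)²)` (`variance_linearizedEstimator`). The Cauchy–Schwarz
inequality for the form `F` bounds this below by `1 / (N bᵀF⁻¹b)`, with equality at `h = F⁻¹b`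
(`patpVariance_optimal`). The closed form of `g₂` follows by inverting `F` explicitly, and its
denominator is positive because `c₂` times the bracket equals
`det F + (ν_{p+1} - p c₂ ν_{p-1})²`.
-/

/-! ### The signed power -/

namespace PATP

/-- The signed power `sign(y) |y| ^ p`. -/
noncomputable def signedPow (p y : ℝ) : ℝ := Real.sign y * |y| ^ p

lemma signedPow_of_nonneg {p y : ℝ} (hp : 0 < p) (hy : 0 ≤ y) : signedPow p y = y ^ p := by
  rcases hy.eq_or_lt with rfl | hy
  · simp [signedPow, Real.zero_rpow hp.ne']
  · simp [signedPow, Real.sign_of_pos hy, abs_of_pos hy]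

lemma signedPow_of_neg {p y : ℝ} (hy : y < 0) : signedPow p y = -(-y) ^ p := by
  simp [signedPow, Real.sign_of_neg hy, abs_of_neg hy]

@[fun_prop]
lemma measurable_signedPow (p : ℝ) : Measurable (signedPow p) := by
  have h : Measurable Real.sign :=
    Measurable.ite measurableSet_Iio measurable_const
      (Measurable.ite measurableSet_Ioi measurable_const measurable_const)
  unfold signedPow
  fun_prop

lemma sign_mul_self (y : ℝ) : Real.sign y * y = |y| := by
  rcases lt_trichotomy y 0 with h | rfl | h
  · simp [Real.sign_of_neg h, abs_of_neg h]
  · simp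
  · simp [Real.sign_of_pos h, abs_of_pos h]

lemma mul_signedPow {p : ℝ} (hp : 0 < p) (y : ℝ) : y * signedPow p y = |y| ^ (p + 1) := by
  rw [Real.rpow_add_one' (abs_nonneg y) (by linarith), signedPow,
    ← sign_mul_self y]
  ring

lemma abs_signedPow {p : ℝ} (hp : 0 < p) (y : ℝ) : |signedPow p y| = |y| ^ p := by
  rcases le_or_gt 0 y with h | h
  · rw [signedPow_of_nonneg hp h, abs_of_nonneg (Real.rpow_nonneg h p), abs_of_nonneg h]
  · rw [signedPow_of_neg h, abs_neg, abs_of_nonneg (Real.rpow_nonneg (by linarith) p), abs_of_neg h]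

lemma signedPow_sq {p : ℝ} (hp : 0 < p) (y : ℝ) : signedPow p y ^ 2 = |y| ^ (2 * p) := by
  rw [← sq_abs, abs_signedPow hp, mul_comm, Real.rpow_mul (abs_nonneg y), Real.rpow_two]

lemma signedPow_neg (p y : ℝ) : signedPow p (-y) = -signedPow p y := by
  simp [signedPow, Real.sign_neg]

lemma sign_mul (x y : ℝ) : Real.sign (x * y) = Real.sign x * Real.sign y := by
  rcases lt_trichotomy x 0 with hx | rfl | hx <;> rcases lt_trichotomy y 0 with hy | rfl | hy <;>
    simp [Real.sign_of_neg, Real.sign_of_pos, mul_pos_of_neg_of_neg, mul_neg_of_neg_of_pos,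
      mul_neg_of_pos_of_neg, *]

lemma signedPow_mul (p x y : ℝ) : signedPow p (x * y) = signedPow p x * signedPow p y := by
  simp only [signedPow, sign_mul, abs_mul, Real.mul_rpow (abs_nonneg x) (abs_nonneg y)]
  ring

lemma hasDerivAt_signedPow_of_ne_zero {p y : ℝ} (hp : 0 < p) (hy : y ≠ 0) :
    HasDerivAt (signedPow p) (p * |y| ^ (p - 1)) y := by
  rcases lt_or_gt_of_ne hy with h | h
  · have h1 := ((hasDerivAt_neg y).rpow_const (p := p) (Or.inl (by linarith))).neg
    have h2 : p * |y| ^ (p - 1) = -(-1 * p * (-y) ^ (p - 1)) := by rw [abs_of_neg h]; ring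
    rw [h2]
    refine h1.congr_of_eventuallyEq ?_
    filter_upwards [gt_mem_nhds h] with z hz using signedPow_of_neg hz
  · rw [abs_of_pos h]
    refine (Real.hasDerivAt_rpow_const (Or.inl hy)).congr_of_eventuallyEq ?_
    filter_upwards [lt_mem_nhds h] with z hz using signedPow_of_nonneg hp hz.le

lemma hasDerivAt_signedPow {p : ℝ} (hp : 1 < p) (y : ℝ) :
    HasDerivAt (signedPow p) (p * |y| ^ (p - 1)) y := by
  rcases eq_or_ne y 0 with rfl | hy
  · -- At the origin the difference quotient is `|z| ^ (p - 1)`, which tends to `0`.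
    rw [hasDerivAt_iff_tendsto_slope]
    have h0 : Filter.Tendsto (fun z : ℝ => |z| ^ (p - 1)) (nhds 0) (nhds (|0| ^ (p - 1))) :=
      (continuous_abs.rpow_const fun _ => Or.inr (by linarith)).tendsto 0
    have h1 : p * |(0 : ℝ)| ^ (p - 1) = |0| ^ (p - 1) := by
      simp [Real.zero_rpow (show p - 1 ≠ 0 by linarith)]
    rw [h1]
    refine (h0.mono_left nhdsWithin_le_nhds).congr' ?_
    filter_upwards [self_mem_nhdsWithin] with z hz
    have hz : z ≠ 0 := hz
    have h2 := mul_signedPow (show 0 < p by linarith) z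
    have h3 : |z| ^ (p + 1) = |z| ^ (p - 1) * z ^ 2 := by
      rw [← sq_abs, ← Real.rpow_two, ← Real.rpow_add (abs_pos.2 hz)]; ring_nf
    have h4 : signedPow p 0 = 0 := by simp [signedPow]
    rw [slope_def_field, h4]
    field_simp
    apply mul_left_cancel₀ hz
    rw [sub_zero, sub_zero, h2, h3]
    ring
  · exact hasDerivAt_signedPow_of_ne_zero (by linarith) hy

/-- A chord of the signed power with exponent at most one through `(1, 1)` has slope
at most `2`. -/
lemma abs_signedPow_sub_one_le {p : ℝ} (hp : 0 < p) (hp1 : p ≤ 1) (t : ℝ) :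
    |signedPow p t - 1| ≤ 2 * |t - 1| := by
  have upper : ∀ s : ℝ, 1 ≤ s → s ^ p ≤ s := fun s hs => by
    simpa using Real.rpow_le_rpow_of_exponent_le hs hp1
  rcases lt_or_ge t 0 with h | h
  · have h0 : (-t) ^ p ≤ 1 + -t :=
      (Real.rpow_le_rpow (by linarith) (by linarith) hp.le).trans (upper (1 + -t) (by linarith))
    have h1 := Real.rpow_nonneg (show 0 ≤ -t by linarith) p
    rw [signedPow_of_neg h, abs_of_neg (by linarith), abs_of_neg (by linarith)]
    linarith
  · rw [signedPow_of_nonneg hp h]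
    rcases le_total 1 t with h1 | h1
    · have h2 := upper t h1
      have h3 := Real.one_le_rpow h1 hp.le
      rw [abs_of_nonneg (by linarith), abs_of_nonneg (by linarith)]
      linarith
    · have h2 := Real.rpow_le_one h h1 hp.le
      have h3 : t ≤ t ^ p := by
        simpa using Real.rpow_le_rpow_of_exponent_ge' h h1 hp.le hp1
      rw [abs_of_nonpos (by linarith), abs_of_nonpos (by linarith)]
      linarith

/-- For an exponent at most one, the difference quotients of the signed power at `y ≠ 0` are
bounded by `2 |y| ^ (p - 1)` for increments of any size, including those that cross the
singularity at the origin. -/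
lemma abs_signedPow_sub_le_of_le_one {p : ℝ} (hp : 0 < p) (hp1 : p ≤ 1) {y : ℝ} (hy : y ≠ 0)
    (z : ℝ) : |signedPow p z - signedPow p y| ≤ 2 * |y| ^ (p - 1) * |z - y| := by
  have h1 : signedPow p z - signedPow p y = signedPow p y * (signedPow p (z / y) - 1) := by
    rw [mul_sub, ← signedPow_mul, mul_div_cancel₀ z hy, mul_one]
  have h2 : z / y - 1 = (z - y) / y := by field_simp
  have hy' : |y| ≠ 0 := abs_ne_zero.2 hy
  calc |signedPow p z - signedPow p y|
      = |y| ^ p * |signedPow p (z / y) - 1| := by rw [h1, abs_mul, abs_signedPow hp]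
    _ ≤ |y| ^ p * (2 * |z / y - 1|) := by
        gcongr
        exact abs_signedPow_sub_one_le hp hp1 _
    _ = 2 * |y| ^ (p - 1) * |z - y| := by
        rw [h2, abs_div, Real.rpow_sub_one hy']
        ring

lemma abs_signedPow_sub_le_of_one_lt {p : ℝ} (hp : 1 < p) (hp2 : p ≤ 2) (y : ℝ) {z : ℝ}
    (hz : |z - y| ≤ 1) :
    |signedPow p z - signedPow p y| ≤ p * (|y| ^ (p - 1) + 1) * |z - y| := by
  have key := (convex_closedBall y 1).norm_image_sub_le_of_norm_hasDerivWithin_le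
    (f := signedPow p) (C := p * (|y| ^ (p - 1) + 1)) (x := y) (y := z)
    (fun w _ => (hasDerivAt_signedPow hp w).hasDerivWithinAt) ?_
    (Metric.mem_closedBall_self zero_le_one) (by simpa [Real.dist_eq] using hz)
  · simpa [Real.norm_eq_abs] using key
  · intro w hw
    rw [Metric.mem_closedBall, Real.dist_eq] at hw
    have hw' : |w| ≤ |y| + 1 := by
      have := abs_sub_abs_le_abs_sub w y
      linarith
    rw [Real.norm_eq_abs, abs_of_nonneg (by positivity)]
    gcongr
    calc |w| ^ (p - 1) ≤ (|y| + 1) ^ (p - 1) :=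
          Real.rpow_le_rpow (abs_nonneg w) hw' (by linarith)
      _ ≤ |y| ^ (p - 1) + 1 ^ (p - 1) :=
          Real.rpow_add_le_add_rpow (abs_nonneg y) zero_le_one (by linarith) (by linarith)
      _ = |y| ^ (p - 1) + 1 := by rw [Real.one_rpow]

/-! ### Differentiation of the mean of the signed power -/

/-- The mean of the signed residual power is differentiable at `θ` in the location parameter.
The difference quotients at the single point `θ` are dominated, although for `p < 1` there is
in general no integrable Lipschitz constant on a neighbourhood of `θ`. -/
lemma hasDerivAt_integral_signedPow (P : Measure ℝ) [IsProbabilityMeasure P] {θ p : ℝ}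
    (hp : 0 < p) (hp1 : p ≠ 1) (hp2 : p ≤ 2)
    (hsub : Integrable (fun x => |x - θ| ^ (p - 1)) P)
    (hint : Integrable (fun x => signedPow p (x - θ)) P)
    (hatom : p < 1 → P {θ} = 0) :
    HasDerivAt (fun t => ∫ x, signedPow p (x - t) ∂P) (-(p * ∫ x, |x - θ| ^ (p - 1) ∂P)) θ := by
  let L : ℝ →L[ℝ] ℝ →L[ℝ] ℝ := ContinuousLinearMap.smulRightL ℝ ℝ ℝ 1
  let f' : ℝ → ℝ := fun x => -(p * |x - θ| ^ (p - 1))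
  have hf' : Integrable f' P := (hsub.const_mul p).neg
  have hcomp : ∀ x, HasDerivAt (signedPow p) (p * |x - θ| ^ (p - 1)) (x - θ) →
      HasFDerivAt (fun t => signedPow p (x - t)) (L (f' x)) θ := by
    intro x hx
    have h := hx.scomp θ ((hasDerivAt_id θ).const_sub x)
    simp only [neg_smul, one_smul] at h
    exact h.hasFDerivAt
  have main : ∃ bound : ℝ → ℝ, Integrable bound P ∧
      (∀ᵐ x ∂P, ∀ t ∈ Metric.ball θ 1,
        ‖signedPow p (x - t) - signedPow p (x - θ)‖ ≤ bound x * ‖t - θ‖) ∧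
      ∀ᵐ x ∂P, HasFDerivAt (fun t => signedPow p (x - t)) (L (f' x)) θ := by
    have hsymm : ∀ x t : ℝ, x - t - (x - θ) = -(t - θ) := fun x t => by ring
    rcases lt_or_gt_of_ne hp1 with h | h
    · have hne : ∀ᵐ x ∂P, x - θ ≠ 0 := by
        have : ∀ᵐ x ∂P, x ∉ ({θ} : Set ℝ) := measure_eq_zero_iff_ae_notMem.1 (hatom h)
        filter_upwards [this] with x hx using sub_ne_zero.2 hx
      refine ⟨fun x => 2 * |x - θ| ^ (p - 1), hsub.const_mul 2, ?_, ?_⟩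
      · filter_upwards [hne] with x hx t _
        have := abs_signedPow_sub_le_of_le_one hp h.le hx (x - t)
        rwa [hsymm, abs_neg] at this
      · filter_upwards [hne] with x hx using hcomp x (hasDerivAt_signedPow_of_ne_zero hp hx)
    · refine ⟨fun x => p * (|x - θ| ^ (p - 1) + 1),
        (hsub.add (integrable_const 1)).const_mul p, ?_, ?_⟩
      · refine Filter.Eventually.of_forall fun x t ht => ?_
        rw [Metric.mem_ball, Real.dist_eq] at ht
        have := abs_signedPow_sub_le_of_one_lt h hp2 (x - θ) (z := x - t)
          (by rw [hsymm, abs_neg]; exact ht.le)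
        rwa [hsymm, abs_neg] at this
      · exact Filter.Eventually.of_forall fun x => hcomp x (hasDerivAt_signedPow h _)
  obtain ⟨bound, hbound, hlip, hdiff⟩ := main
  have key := (hasFDerivAt_integral_of_dominated_loc_of_lip' (𝕜 := ℝ)
    (F := fun t x => signedPow p (x - t)) (Metric.ball_mem_nhds θ one_pos)
    (fun t _ => ((measurable_signedPow p).comp
      (measurable_id.sub_const t)).aestronglyMeasurable) hint
    (L.continuous.comp_aestronglyMeasurable hf'.aestronglyMeasurable) hlip hbound hdiff).2
  rw [ContinuousLinearMap.integral_comp_comm L hf'] at key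
  have : ∫ x, f' x ∂P = -(p * ∫ x, |x - θ| ^ (p - 1) ∂P) := by
    rw [integral_neg, integral_const_mul]
  rw [← this, hasDerivAt_iff_hasFDerivAt]
  exact key

end PATP

/-! ### Sampling variance of the linearized estimator -/

namespace PATP

lemma basis_two {α p : ℝ} (hp : exponent 2 α = p) : basis α 2 = signedPow p := by
  funext y
  simp [basis, signedPow, hp]

lemma basis_one (α : ℝ) : basis α 1 = id := by
  funext y
  simp [basis]

lemma variance_sampleMean {P : Measure ℝ} [IsProbabilityMeasure P] {Y : ℝ → ℝ} (hY : MemLp Y 2 P)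
    (N : ℕ) : Var[fun x : Fin N → ℝ => (∑ n, Y (x n)) / N; sampleLaw P N] = Var[Y; P] / N := by
  rcases N.eq_zero_or_pos with rfl | hN
  · simp [variance_zero, ← Pi.zero_def]
  have h := variance_sum_pi (μ := fun _ : Fin N => P) (X := fun _ => Y) fun _ => hY
  have h1 : (∑ n : Fin N, fun x : Fin N → ℝ => Y (x n)) = fun x => ∑ n, Y (x n) := by
    funext x
    simp
  rw [h1] at h
  have hN' : (N : ℝ) ≠ 0 := by positivity
  simp only [div_eq_mul_inv, variance_mul_const, sampleLaw, h, Finset.sum_const, Finset.card_univ,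
    Fintype.card_fin, nsmul_eq_mul]
  field_simp

lemma F_apply_eq_covariance {P : Measure ℝ} [IsProbabilityMeasure P] {θ α : ℝ} {S : ℕ}
    (hφ : ∀ i : Fin S, MemLp (fun x => basis α (i + 1) (x - θ)) 2 P) (i j : Fin S) :
    F P θ α S i j =
      cov[fun x => basis α (i + 1) (x - θ), fun x => basis α (j + 1) (x - θ); P] := by
  rw [covariance_eq_sub (hφ i) (hφ j)]
  rfl

lemma variance_linearCombination {P : Measure ℝ} [IsProbabilityMeasure P] {θ α : ℝ} {S : ℕ}
    (hφ : ∀ i : Fin S, MemLp (fun x => basis α (i + 1) (x - θ)) 2 P) (h : Fin S → ℝ) :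
    Var[fun x => ∑ i, h i * basis α (i + 1) (x - θ); P] = h ⬝ᵥ (F P θ α S *ᵥ h) := by
  rw [variance_fun_sum fun i => (hφ i).const_mul (h i)]
  simp only [covariance_const_mul_left, covariance_const_mul_right, dotProduct, mulVec,
    F_apply_eq_covariance hφ, Finset.mul_sum]
  refine Finset.sum_congr rfl fun i _ => Finset.sum_congr rfl fun j _ => ?_
  ring

lemma variance_linearizedEstimator {P : Measure ℝ} [IsProbabilityMeasure P] {θ α : ℝ} {S : ℕ}
    (hφ : ∀ i : Fin S, MemLp (fun x => basis α (i + 1) (x - θ)) 2 P) (h : Fin S → ℝ) (N : ℕ) :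
    Var[linearizedEstimator P θ α S h N; sampleLaw P N] =
      h ⬝ᵥ (F P θ α S *ᵥ h) / (N * (h ⬝ᵥ b P θ α S) ^ 2) := by
  set Y : ℝ → ℝ := fun x => ∑ i, h i * basis α (i + 1) (x - θ) with hYdef
  have hY : MemLp Y 2 P := memLp_finsetSum _ fun i _ => (hφ i).const_mul (h i)
  have hlin : linearizedEstimator P θ α S h N =
      fun x => θ + (∑ n, Y (x n)) / N * (h ⬝ᵥ b P θ α S)⁻¹ := by
    funext x
    simp only [linearizedEstimator, hYdef, div_eq_mul_inv]
    rw [Finset.sum_comm]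
    simp only [Finset.sum_mul, Finset.mul_sum, mul_assoc]
  have hmeas : AEStronglyMeasurable
      (fun x : Fin N → ℝ => (∑ n, Y (x n)) / N * (h ⬝ᵥ b P θ α S)⁻¹) (sampleLaw P N) := by
    have hn : ∀ n : Fin N, MemLp (fun x : Fin N → ℝ => Y (x n)) 2 (sampleLaw P N) := fun n =>
      hY.comp_measurePreserving (measurePreserving_eval (fun _ : Fin N => P) n)
    have hs := memLp_finsetSum Finset.univ fun n _ => hn n
    simp only [div_eq_mul_inv]
    exact ((hs.mul_const _).mul_const _).aestronglyMeasurable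
  have : IsProbabilityMeasure (sampleLaw P N) := by unfold sampleLaw; infer_instance
  rw [hlin, variance_const_add hmeas, variance_mul_const, variance_sampleMean hY,
    variance_linearCombination hφ]
  rw [inv_pow, ← div_eq_mul_inv, div_div]

/-- The Cauchy–Schwarz inequality for the symmetric form of a matrix `A` that is nonnegative on
every vector, against a solution `u` of `A u = b`. -/
lemma sq_dotProduct_div_le {ι : Type*} [Fintype ι] {A : Matrix ι ι ℝ} (hA : A.IsSymm)
    (hpos : ∀ v, 0 ≤ v ⬝ᵥ (A *ᵥ v)) {u w : ι → ℝ} (hu : A *ᵥ u = w) (hw : 0 < w ⬝ᵥ u)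
    (h : ι → ℝ) : (h ⬝ᵥ w) ^ 2 / (w ⬝ᵥ u) ≤ h ⬝ᵥ (A *ᵥ h) := by
  have hcross : u ⬝ᵥ (A *ᵥ h) = h ⬝ᵥ w := by
    rw [dotProduct_mulVec, ← mulVec_transpose, hA.eq, hu, dotProduct_comm]
  -- The defect of the inequality is the form at the component of `h` orthogonal to `u`.
  have key := hpos (h - (h ⬝ᵥ w / (w ⬝ᵥ u)) • u)
  simp only [mulVec_sub, mulVec_smul, sub_dotProduct, dotProduct_sub, smul_dotProduct,
    dotProduct_smul, smul_eq_mul, hu, hcross, dotProduct_comm u w] at key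
  have : h ⬝ᵥ (A *ᵥ h) - h ⬝ᵥ w / (w ⬝ᵥ u) * (h ⬝ᵥ w) - h ⬝ᵥ w / (w ⬝ᵥ u) *
      (h ⬝ᵥ w - h ⬝ᵥ w / (w ⬝ᵥ u) * (w ⬝ᵥ u)) =
      h ⬝ᵥ (A *ᵥ h) - (h ⬝ᵥ w) ^ 2 / (w ⬝ᵥ u) := by
    field_simp
    ring
  linarith

/-- The optimal coefficients attain the asymptotic variance, and no other coefficients do
better. -/
lemma patpVariance_optimal {P : Measure ℝ} [IsProbabilityMeasure P] {θ α : ℝ} {S : ℕ}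
    (hφ : ∀ i : Fin S, MemLp (fun x => basis α (i + 1) (x - θ)) 2 P)
    (hdet : (F P θ α S).det ≠ 0)
    (hq : 0 < b P θ α S ⬝ᵥ ((F P θ α S)⁻¹ *ᵥ b P θ α S)) (N : ℕ) :
    F P θ α S *ᵥ optimalCoeff P θ α S = b P θ α S ∧
    Var[linearizedEstimator P θ α S (optimalCoeff P θ α S) N; sampleLaw P N] =
      patpVariance P θ α S N ∧
    ∀ h : Fin S → ℝ, h ⬝ᵥ b P θ α S ≠ 0 →
      patpVariance P θ α S N ≤ Var[linearizedEstimator P θ α S h N; sampleLaw P N] := by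
  have hsolve : F P θ α S *ᵥ optimalCoeff P θ α S = b P θ α S := by
    rw [optimalCoeff, mulVec_mulVec, mul_nonsing_inv _ (isUnit_iff_ne_zero.2 hdet), one_mulVec]
  have hsymm : (F P θ α S).IsSymm := by
    refine IsSymm.ext fun i j => ?_
    rw [F_apply_eq_covariance hφ, F_apply_eq_covariance hφ, covariance_comm]
  have hpos : ∀ v, 0 ≤ v ⬝ᵥ (F P θ α S *ᵥ v) := fun v => by
    rw [← variance_linearCombination hφ]
    exact variance_nonneg _ _
  refine ⟨hsolve, ?_, fun h hh => ?_⟩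
  · rw [variance_linearizedEstimator hφ, hsolve, dotProduct_comm (optimalCoeff P θ α S),
      patpVariance]
    change b P θ α S ⬝ᵥ optimalCoeff P θ α S / (N * (b P θ α S ⬝ᵥ optimalCoeff P θ α S) ^ 2) =
      1 / (N * (b P θ α S ⬝ᵥ optimalCoeff P θ α S))
    change 0 < b P θ α S ⬝ᵥ optimalCoeff P θ α S at hq
    field_simp
  · have hcs := sq_dotProduct_div_le hsymm hpos hsolve hq h
    rw [variance_linearizedEstimator hφ, mul_comm (N : ℝ), ← div_div]
    calc patpVariance P θ α S N
        = (h ⬝ᵥ b P θ α S) ^ 2 / (b P θ α S ⬝ᵥ optimalCoeff P θ α S) /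
            (h ⬝ᵥ b P θ α S) ^ 2 / N := by
          change 1 / (N * (b P θ α S ⬝ᵥ optimalCoeff P θ α S)) = _
          field_simp
      _ ≤ _ := by gcongr

/-! ### The degree-two basis -/

/-- The quadratic form of the inverse of a symmetric two-by-two matrix. -/
lemma dotProduct_inv_mulVec_fin_two (a m d β : ℝ) :
    ![1, β] ⬝ᵥ ((!![a, m; m, d] : Matrix (Fin 2) (Fin 2) ℝ)⁻¹ *ᵥ ![1, β]) =
      (d - 2 * β * m + a * β ^ 2) / (a * d - m ^ 2) := by
  rw [inv_def, adjugate_fin_two_of, det_fin_two_of, Ring.inverse_eq_inv']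
  simp [dotProduct, mulVec, Fin.sum_univ_two]
  ring

end PATP

theorem mainTheorem1 (P : Measure ℝ) [IsProbabilityMeasure P] (θ₀ α p : ℝ)
    (hα : α ∈ Set.Icc (0 : ℝ) 1) (hα_half : α ≠ 1 / 2)
    (hp : p = 1 / 2 + 1 / 2 * α + α ^ 2)
    -- the residual `ξ = X - θ₀` is centered
    (hmean : ∫ x, x ∂P = θ₀)
    -- the moments entering the formula are finite
    (hc₂ : Integrable (fun x => (x - θ₀) ^ 2) P)
    (hν_sub : Integrable (fun x => |x - θ₀| ^ (p - 1)) P)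
    (hν_add : Integrable (fun x => |x - θ₀| ^ (p + 1)) P)
    (hν_two : Integrable (fun x => |x - θ₀| ^ (2 * p)) P)
    (hσ : Integrable (fun x => Real.sign (x - θ₀) * |x - θ₀| ^ p) P)
    -- no atom at the center when the exponent is below one
    (hatom : p < 1 → P {θ₀} = 0)
    -- the matrix of centered correlants is non-degenerate
    (hΔ : 0 < (PATP.F P θ₀ α 2).det) :
    -- the exponent, the correlants and the derivatives of the basis means
    PATP.exponent 2 α = p ∧
    PATP.F P θ₀ α 2 =
      !![PATP.c₂ P θ₀, PATP.ν P θ₀ (p + 1);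
         PATP.ν P θ₀ (p + 1), PATP.ν P θ₀ (2 * p) - PATP.σ P θ₀ p ^ 2] ∧
    HasDerivAt (PATP.Ψ P α 1) (-1) θ₀ ∧
    HasDerivAt (PATP.Ψ P α 2) (-(p * PATP.ν P θ₀ (p - 1))) θ₀ ∧
    PATP.b P θ₀ α 2 = ![1, p * PATP.ν P θ₀ (p - 1)] ∧
    -- non-vanishing of the denominator
    0 < PATP.c₂ P θ₀ ∧
    0 < (PATP.ν P θ₀ (2 * p) - PATP.σ P θ₀ p ^ 2)
          - 2 * p * PATP.ν P θ₀ (p + 1) * PATP.ν P θ₀ (p - 1)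
          + p ^ 2 * PATP.c₂ P θ₀ * PATP.ν P θ₀ (p - 1) ^ 2 ∧
    -- the optimal coefficients solve the normal equations
    PATP.F P θ₀ α 2 *ᵥ PATP.optimalCoeff P θ₀ α 2 = PATP.b P θ₀ α 2 ∧
    ∀ N : ℕ, 1 ≤ N →
      -- the two variances
      PATP.olsVariance P N = PATP.c₂ P θ₀ / N ∧
      variance (PATP.linearizedEstimator P θ₀ α 2 (PATP.optimalCoeff P θ₀ α 2) N)
          (PATP.sampleLaw P N) = PATP.patpVariance P θ₀ α 2 N ∧
      (∀ h : Fin 2 → ℝ, h ⬝ᵥ PATP.b P θ₀ α 2 ≠ 0 →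
        PATP.patpVariance P θ₀ α 2 N ≤
          variance (PATP.linearizedEstimator P θ₀ α 2 h N) (PATP.sampleLaw P N)) ∧
      -- the closed form of the variance reduction coefficient
      PATP.g P θ₀ α 2 N =
        1 / (PATP.c₂ P θ₀ *
          (PATP.b P θ₀ α 2 ⬝ᵥ ((PATP.F P θ₀ α 2)⁻¹ *ᵥ PATP.b P θ₀ α 2))) ∧
      PATP.g P θ₀ α 2 N =
        (PATP.c₂ P θ₀ * (PATP.ν P θ₀ (2 * p) - PATP.σ P θ₀ p ^ 2) - PATP.ν P θ₀ (p + 1) ^ 2) /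
        (PATP.c₂ P θ₀ *
          ((PATP.ν P θ₀ (2 * p) - PATP.σ P θ₀ p ^ 2)
            - 2 * p * PATP.ν P θ₀ (p + 1) * PATP.ν P θ₀ (p - 1)
            + p ^ 2 * PATP.c₂ P θ₀ * PATP.ν P θ₀ (p - 1) ^ 2)) ∧
      -- symmetric laws at the endpoint `α = 1`
      (α = 1 → P.map (fun x => x - θ₀) = P.map (fun x => -(x - θ₀)) →
        PATP.g P θ₀ α 2 N =
          (PATP.c₂ P θ₀ * PATP.ν P θ₀ 4 - PATP.ν P θ₀ 3 ^ 2) /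
          (PATP.c₂ P θ₀ *
            (PATP.ν P θ₀ 4 - 4 * PATP.ν P θ₀ 3 * PATP.ν P θ₀ 1
              + 4 * PATP.c₂ P θ₀ * PATP.ν P θ₀ 1 ^ 2))) := by
  have hexp : PATP.exponent 2 α = p := by
    rw [hp, PATP.exponent]
    push_cast
    ring
  obtain ⟨hα0, hα1⟩ := hα
  have hp_pos : 0 < p := by rw [hp]; positivity
  have hp_le : p ≤ 2 := by rw [hp]; nlinarith
  -- `p - 1 = (α - 1/2)(α + 1)`, so `p = 1` is excluded together with `α = 1/2`.
  have hp_ne : p ≠ 1 := fun h1 => by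
    have h0 : (α - 1 / 2) * (α + 1) = 0 := by linear_combination h1 - hp
    rcases mul_eq_zero.1 h0 with h | h
    · exact hα_half (by linarith)
    · linarith
  -- Both basis functions are square integrable.
  have hφ1 : MemLp (fun x => x - θ₀) 2 P :=
    (memLp_two_iff_integrable_sq (by fun_prop)).2 hc₂
  have hφ2 : MemLp (fun x => PATP.signedPow p (x - θ₀)) 2 P := by
    refine (memLp_two_iff_integrable_sq ((PATP.measurable_signedPow p).comp
      (measurable_id.sub_const θ₀)).aestronglyMeasurable).2 ?_
    simpa only [Function.comp_apply, id, PATP.signedPow_sq hp_pos] using hν_two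
  have hφ : ∀ i : Fin 2, MemLp (fun x => PATP.basis α (i + 1) (x - θ₀)) 2 P := by
    intro i
    fin_cases i
    · simpa [PATP.basis_one] using hφ1
    · simpa [PATP.basis_two hexp] using hφ2
  have hid : MemLp (fun x : ℝ => x) 2 P :=
    (memLp_congr_ae (Filter.Eventually.of_forall fun x => by simp)).1 (hφ1.add (memLp_const θ₀))
  have hint : Integrable (fun x : ℝ => x) P := hid.integrable one_le_two
  have hΨ1 : ∀ t, PATP.Ψ P α 1 t = θ₀ - t := fun t => by
    simp [PATP.Ψ, PATP.basis_one, integral_sub hint (integrable_const t), hmean]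
  have hΨ2 : PATP.Ψ P α 2 = fun t => ∫ x, PATP.signedPow p (x - t) ∂P := by
    funext t
    rw [PATP.Ψ, PATP.basis_two hexp]
  have hF : PATP.F P θ₀ α 2 =
      !![PATP.c₂ P θ₀, PATP.ν P θ₀ (p + 1);
         PATP.ν P θ₀ (p + 1), PATP.ν P θ₀ (2 * p) - PATP.σ P θ₀ p ^ 2] := by
    have hΨ0 : PATP.Ψ P α 1 θ₀ = 0 := by rw [hΨ1, sub_self]
    have h11 : PATP.Ψ₂ P α 1 1 θ₀ = PATP.c₂ P θ₀ := by
      simp [PATP.Ψ₂, PATP.c₂, PATP.basis_one, sq]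
    have h12 : PATP.Ψ₂ P α 1 2 θ₀ = PATP.ν P θ₀ (p + 1) := by
      simp [PATP.Ψ₂, PATP.ν, PATP.basis_one, PATP.basis_two hexp, PATP.mul_signedPow hp_pos]
    have h21 : PATP.Ψ₂ P α 2 1 θ₀ = PATP.ν P θ₀ (p + 1) := by
      rw [← h12]
      simp only [PATP.Ψ₂, mul_comm]
    have h22 : PATP.Ψ₂ P α 2 2 θ₀ = PATP.ν P θ₀ (2 * p) := by
      simp [PATP.Ψ₂, PATP.ν, PATP.basis_two hexp, ← sq, PATP.signedPow_sq hp_pos]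
    have hσ' : PATP.Ψ P α 2 θ₀ = PATP.σ P θ₀ p := by rw [hΨ2]; rfl
    ext i j
    fin_cases i <;> fin_cases j <;>
      simp [PATP.F, hΨ0, h11, h12, h21, h22, hσ', sq]
  have hd1 : HasDerivAt (PATP.Ψ P α 1) (-1) θ₀ := by
    rw [funext hΨ1]
    exact (hasDerivAt_id θ₀).const_sub θ₀
  have hd2 : HasDerivAt (PATP.Ψ P α 2) (-(p * PATP.ν P θ₀ (p - 1))) θ₀ := by
    rw [hΨ2]
    exact PATP.hasDerivAt_integral_signedPow P hp_pos hp_ne hp_le hν_sub hσ hatom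
  have hb : PATP.b P θ₀ α 2 = ![1, p * PATP.ν P θ₀ (p - 1)] := by
    ext i
    fin_cases i
    · simp [PATP.b, hd1.deriv]
    · simp [PATP.b, hd2.deriv]
  have hq := PATP.dotProduct_inv_mulVec_fin_two (PATP.c₂ P θ₀) (PATP.ν P θ₀ (p + 1))
    (PATP.ν P θ₀ (2 * p) - PATP.σ P θ₀ p ^ 2) (p * PATP.ν P θ₀ (p - 1))
  rw [← hF, ← hb] at hq
  have hdet : 0 < PATP.c₂ P θ₀ * (PATP.ν P θ₀ (2 * p) - PATP.σ P θ₀ p ^ 2)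
      - PATP.ν P θ₀ (p + 1) ^ 2 := by
    rw [hF, det_fin_two_of] at hΔ
    linarith
  have hc : 0 < PATP.c₂ P θ₀ := by
    refine lt_of_le_of_ne (integral_nonneg fun x => sq_nonneg _) fun h => ?_
    rw [← h] at hdet
    nlinarith [sq_nonneg (PATP.ν P θ₀ (p + 1))]
  have hden : 0 < (PATP.ν P θ₀ (2 * p) - PATP.σ P θ₀ p ^ 2)
          - 2 * p * PATP.ν P θ₀ (p + 1) * PATP.ν P θ₀ (p - 1)
          + p ^ 2 * PATP.c₂ P θ₀ * PATP.ν P θ₀ (p - 1) ^ 2 := by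
    -- Completing the square: `c₂` times the denominator exceeds `det F` by a square.
    refine pos_of_mul_pos_right (a := PATP.c₂ P θ₀) ?_ hc.le
    nlinarith [sq_nonneg (PATP.ν P θ₀ (p + 1) - p * PATP.c₂ P θ₀ * PATP.ν P θ₀ (p - 1))]
  have hq' : PATP.b P θ₀ α 2 ⬝ᵥ ((PATP.F P θ₀ α 2)⁻¹ *ᵥ PATP.b P θ₀ α 2) =
      ((PATP.ν P θ₀ (2 * p) - PATP.σ P θ₀ p ^ 2)
          - 2 * p * PATP.ν P θ₀ (p + 1) * PATP.ν P θ₀ (p - 1)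
          + p ^ 2 * PATP.c₂ P θ₀ * PATP.ν P θ₀ (p - 1) ^ 2) /
        (PATP.c₂ P θ₀ * (PATP.ν P θ₀ (2 * p) - PATP.σ P θ₀ p ^ 2)
          - PATP.ν P θ₀ (p + 1) ^ 2) := by
    rw [hq]
    congr 1
    ring
  have hq_pos : 0 < PATP.b P θ₀ α 2 ⬝ᵥ ((PATP.F P θ₀ α 2)⁻¹ *ᵥ PATP.b P θ₀ α 2) := by
    rw [hq']
    positivity
  have hopt := PATP.patpVariance_optimal hφ hΔ.ne' hq_pos
  refine ⟨hexp, hF, hd1, hd2, hb, hc, hden, (hopt 0).1, fun N hN => ?_⟩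
  have hN' : (0 : ℝ) < N := by exact_mod_cast hN
  have hols : PATP.olsVariance P N = PATP.c₂ P θ₀ / N := by
    have h := PATP.variance_sampleMean hid N
    rwa [variance_eq_integral hid.aemeasurable, hmean] at h
  have hg : PATP.g P θ₀ α 2 N =
      1 / (PATP.c₂ P θ₀ *
        (PATP.b P θ₀ α 2 ⬝ᵥ ((PATP.F P θ₀ α 2)⁻¹ *ᵥ PATP.b P θ₀ α 2))) := by
    rw [PATP.g, hols, PATP.patpVariance]
    field_simp
  have hg' : PATP.g P θ₀ α 2 N =
        (PATP.c₂ P θ₀ * (PATP.ν P θ₀ (2 * p) - PATP.σ P θ₀ p ^ 2) - PATP.ν P θ₀ (p + 1) ^ 2) /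
        (PATP.c₂ P θ₀ *
          ((PATP.ν P θ₀ (2 * p) - PATP.σ P θ₀ p ^ 2)
            - 2 * p * PATP.ν P θ₀ (p + 1) * PATP.ν P θ₀ (p - 1)
            + p ^ 2 * PATP.c₂ P θ₀ * PATP.ν P θ₀ (p - 1) ^ 2)) := by
    rw [hg, hq', mul_div_assoc', one_div_div]
  refine ⟨hols, (hopt N).2.1, (hopt N).2.2, hg, hg', fun hα_one hsymm => ?_⟩
  -- The signed power is odd, so its mean vanishes under a symmetric law.
  have hσ0 : PATP.σ P θ₀ p = 0 := by
    have h1 : ∫ y, PATP.signedPow p y ∂(P.map fun x => x - θ₀) =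
        ∫ y, PATP.signedPow p y ∂(P.map fun x => -(x - θ₀)) := by rw [hsymm]
    rw [integral_map (by fun_prop) (PATP.measurable_signedPow p).aestronglyMeasurable,
      integral_map (by fun_prop) (PATP.measurable_signedPow p).aestronglyMeasurable] at h1
    simp only [PATP.signedPow_neg, integral_neg] at h1
    change PATP.σ P θ₀ p = -PATP.σ P θ₀ p at h1
    linarith
  have hp_two : p = 2 := by rw [hp, hα_one]; norm_num
  rw [hg', hσ0, hp_two]
  norm_num
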